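/- **Conventions.** Let $f:X\to V$ be a continuous map from a Hausdorff topological space $X$ to a real topological vector space $V$. A *convex cone with vertex* $v_0$ in $V$ is a convex set $C\subset V$ with $v_0\in C$ such that $(1-\lambda)v_0+\lambda v\in C$ for all $v\in C$, $v\ne v_0$, and all $\lambda\ge 0$; it carries the subspace topology. The map $f$ has *local convexity data* if for each $x\in X$ and every sufficiently small open neighborhood $U_x$ of $x$ (that is, every open neighborhood contained in some fixed neighborhood of $x$) there is a convex cone $C$ in $V$ with vertex $f(x)$ (not assumed to be closed, and allowed to depend on $x$ and $U_x$) such that - (VN) $f(U_x)\subset C$, and $f(U_x)$ is a neighborhood of the vertex $f(x)$ in $C$; - (SLO) $f|_{U_x}:U_x\to C$ is an open map, and for every neighborhood $U_x'\subset U_x$ of $x$ the set $f(U_x')$ is a neighborhood of $f(x)$ in $C$. The map $f$ is *locally fiber connected* if for each $x\in X$ every open neighborhood of $x$ contains a neighborhood $U_x$ of $x$ that does not meet two different connected components of the fiber $f^{-1}(f(u))$, for any $u\in U_x$. **Theorem (generalized Lokal-global-Prinzip).** Let $X$ be a connected, locally connected, first countable, normal Hausdorff topological space, let $V$ be a finite-dimensional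 Euclidean vector space, and let $f:X\to V$ be a continuous closed map that has local convexity data and is locally fiber connected. Then: 1. for every $v\in f(X)$ the fiber $f^{-1}(v)$ is connected; 2. $f$ is open onto its image, i.e. $f:X\to f(X)$ is an open map, where $f(X)$ has the subspace topology; 3. the image $f(X)$ is a closed convex subset of $V$. (The fibers of $f$ are not assumed to be compact, so $f$ need not be proper.) -/

import Mathlib

open Set Topology

/-- `C` is a cone with vertex `v₀`: it contains `v₀`, and with each point `v ≠ v₀` the whole closed
ray from `v₀` through `v`. -/
def IsConeWithVertex {V : Type*} [AddCommGroup V] [Module ℝ V] (C : Set V) (v₀ : V) : Prop :=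
  v₀ ∈ C ∧ ∀ v ∈ C, v ≠ v₀ → ∀ t : ℝ, 0 ≤ t → (1 - t) • v₀ + t • v ∈ C

/-- `C` is a convex cone with vertex `v₀`. -/
def IsConvexConeWithVertex {V : Type*} [AddCommGroup V] [Module ℝ V]
    (C : Set V) (v₀ : V) : Prop :=
  IsConeWithVertex C v₀ ∧ Convex ℝ C

/-- The map `f` and the cone `C` (with its subspace topology) satisfy the vertex neighborhood
condition (VN) and the strong local openness condition (SLO) on the neighborhood `U` of `x`. -/
structure IsConvexityDatum {X V : Type*} [TopologicalSpace X] [AddCommGroup V] [Module ℝ V]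
    [TopologicalSpace V] (f : X → V) (x : X) (U : Set X) (C : Set V) : Prop where
  cone : IsConvexConeWithVertex C (f x)
  mapsTo : MapsTo f U C
  /-- (VN): `f(U)` is a neighborhood of the vertex `f x` in `C`. -/
  vertex_nhds : f '' U ∈ 𝓝[C] (f x)
  /-- (SLO), first part: the restriction `U → C` of `f` is an open map. -/
  open_restrict : IsOpenMap (mapsTo.restrict f U C)
  /-- (SLO), second part: smaller neighborhoods of `x` are mapped to neighborhoods of the vertex
  in `C`. -/
  strong_open : ∀ U' ∈ 𝓝 x, U' ⊆ U → f '' U' ∈ 𝓝[C] (f x)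

/-- `f` has local convexity data: for each `x`, every sufficiently small open neighborhood `U` of
`x` admits a convex cone with vertex `f x` satisfying (VN) and (SLO). -/
def HasLocalConvexityData {X V : Type*} [TopologicalSpace X] [AddCommGroup V] [Module ℝ V]
    [TopologicalSpace V] (f : X → V) : Prop :=
  ∀ x : X, ∃ W ∈ 𝓝 x, ∀ U : Set X, IsOpen U → x ∈ U → U ⊆ W →
    ∃ C : Set V, IsConvexityDatum f x U C

/-- The set `A` satisfies (LFC): it does not meet two different connected components of a fiber
of `f`. -/
def SatisfiesLFC {X Y : Type*} [TopologicalSpace X] (f : X → Y) (A : Set X) : Prop :=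
  ∀ x ∈ A, ∀ y ∈ A, f x = f y →
    connectedComponentIn (f ⁻¹' {f x}) x = connectedComponentIn (f ⁻¹' {f x}) y

/-- `f` is locally fiber connected: every open neighborhood of every point `x` contains a
neighborhood of `x` that satisfies (LFC). -/
def IsLocallyFiberConnected {X Y : Type*} [TopologicalSpace X] (f : X → Y) : Prop :=
  ∀ x : X, ∀ O : Set X, IsOpen O → x ∈ O → ∃ U ∈ 𝓝 x, U ⊆ O ∧ SatisfiesLFC f U

/-! Local convexity and local fiber connectedness give charts: open sets with convex image, on which
`f` is open onto that image and satisfies (LFC). The core is that the preimage of a compact convex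
`K` cannot be split by two open sets (`notSeparatedIn_preimage_of_isCompact`). With `g` the distance
to `K`, two points over `K` are unseparated in some sublevel set of `g ∘ f`. The infimum of such
levels is attained, since `f` is closed and `X` normal, and a positive level can be lowered, since
`g` is convex; hence it is zero. A one-point `K` gives connected fibers, a segment gives convexity
of the image. Openness follows because the image of the neighborhood filter is constant along a
connected fiber. -/

/-- `y` lies in every relatively clopen part of `P` that contains `x`, the relatively clopen parts
being given by pairs of open sets covering `P` and disjoint on `P`. -/
def NotSeparatedIn {X : Type*} [TopologicalSpace X] (P : Set X) (x y : X) : Prop :=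
  ∀ O₁ O₂ : Set X, IsOpen O₁ → IsOpen O₂ → P ⊆ O₁ ∪ O₂ → (∀ z ∈ P, z ∈ O₁ → z ∉ O₂) →
    x ∈ O₁ → y ∈ O₁

namespace NotSeparatedIn

variable {X : Type*} [TopologicalSpace X] {P P' : Set X} {x y z : X}

theorem refl (P : Set X) (x : X) : NotSeparatedIn P x x := fun _ _ _ _ _ _ h => h

theorem trans (h₁ : NotSeparatedIn P x y) (h₂ : NotSeparatedIn P y z) : NotSeparatedIn P x z :=
  fun O₁ O₂ ho₁ ho₂ hc hd hx => h₂ O₁ O₂ ho₁ ho₂ hc hd (h₁ O₁ O₂ ho₁ ho₂ hc hd hx)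

theorem mono (h : NotSeparatedIn P x y) (hP : P ⊆ P') : NotSeparatedIn P' x y :=
  fun O₁ O₂ ho₁ ho₂ hc hd => h O₁ O₂ ho₁ ho₂ (hP.trans hc) fun z hz => hd z (hP hz)

end NotSeparatedIn

/-! ### Convex charts -/

/-- An open set with convex image on which `f` is open onto its image and satisfies (LFC). -/
structure IsConvexChart {X V : Type*} [TopologicalSpace X] [AddCommGroup V] [Module ℝ V]
    [TopologicalSpace V] (f : X → V) (U : Set X) : Prop where
  isOpen : IsOpen U
  convex_image : Convex ℝ (f '' U)
  image_open : ∀ G : Set X, IsOpen G → G ⊆ U → ∃ W : Set V, IsOpen W ∧ f '' G = W ∩ f '' U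
  lfc : SatisfiesLFC f U

theorem exists_isConvexChart {X V : Type*} [TopologicalSpace X] [NormedAddCommGroup V]
    [NormedSpace ℝ V] {f : X → V} (hcont : Continuous f) (hlcd : HasLocalConvexityData f)
    (hlfc : IsLocallyFiberConnected f) (x : X) : ∃ U, x ∈ U ∧ IsConvexChart f U := by
  obtain ⟨W, hW, hWU⟩ := hlcd x
  obtain ⟨U', hU', hU'W, hU'f⟩ :=
    hlfc x (interior W) isOpen_interior (mem_interior_iff_mem_nhds.2 hW)
  obtain ⟨C, hC⟩ := hWU (interior U') isOpen_interior (mem_interior_iff_mem_nhds.2 hU')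
    (interior_subset.trans (hU'W.trans interior_subset))
  obtain ⟨r, hr, hrC⟩ := Metric.mem_nhdsWithin_iff.1 hC.vertex_nhds
  -- By (VN) the image fills the cone near its vertex, so cutting down to a small ball makes it
  -- convex.
  have himage : f '' (interior U' ∩ f ⁻¹' Metric.ball (f x) r) = C ∩ Metric.ball (f x) r := by
    rw [image_inter_preimage]
    ext v
    exact ⟨fun h => ⟨hC.mapsTo.image_subset h.1, h.2⟩, fun h => ⟨hrC ⟨h.2, h.1⟩, h.2⟩⟩
  refine ⟨interior U' ∩ f ⁻¹' Metric.ball (f x) r,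
    ⟨mem_interior_iff_mem_nhds.2 hU', Metric.mem_ball_self hr⟩,
    isOpen_interior.inter (Metric.isOpen_ball.preimage hcont), ?_, ?_, ?_⟩
  · rw [himage]
    exact hC.cone.2.inter (convex_ball _ _)
  · intro G hG hGU
    obtain ⟨W', hW'o, hW'⟩ := isOpen_induced_iff.1
      (hC.open_restrict _ (hG.preimage continuous_subtype_val))
    refine ⟨W', hW'o, ?_⟩
    rw [himage]
    ext v
    constructor
    · rintro ⟨z, hz, rfl⟩
      have h1 : (⟨f z, hC.mapsTo (hGU hz).1⟩ : C) ∈ Subtype.val ⁻¹' W' := by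
        rw [hW']
        exact ⟨⟨z, (hGU hz).1⟩, hz, rfl⟩
      exact ⟨h1, hC.mapsTo (hGU hz).1, (hGU hz).2⟩
    · rintro ⟨hv, hvC, -⟩
      have h1 : (⟨v, hvC⟩ : C) ∈ Subtype.val ⁻¹' W' := hv
      rw [hW'] at h1
      obtain ⟨z, hz, hzv⟩ := h1
      exact ⟨z, hz, congrArg Subtype.val hzv⟩
  · exact fun a ha b hb => hU'f a (interior_subset ha.1) b (interior_subset hb.1)

/-- The convex set `f '' U ∩ A` is connected, so the open images of the two pieces share a value
`u`. By (LFC) the points over `u` in the two pieces lie in one fiber component, which the pieces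
would split. -/
theorem IsConvexChart.notSeparatedIn {X V : Type*} [TopologicalSpace X] [NormedAddCommGroup V]
    [NormedSpace ℝ V] {f : X → V} {U : Set X} (hU : IsConvexChart f U) {A : Set V}
    (hA : Convex ℝ A) {a b : X} (ha : a ∈ U) (hb : b ∈ U) (haA : f a ∈ A) (hbA : f b ∈ A) :
    NotSeparatedIn (f ⁻¹' A) a b := by
  intro O₁ O₂ ho₁ ho₂ hc hd ha₁
  by_contra hb₁
  have hb₂ : b ∈ O₂ := (hc hbA).resolve_left hb₁
  obtain ⟨W₁, hW₁, h₁⟩ := hU.image_open (U ∩ O₁) (hU.isOpen.inter ho₁) inter_subset_left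
  obtain ⟨W₂, hW₂, h₂⟩ := hU.image_open (U ∩ O₂) (hU.isOpen.inter ho₂) inter_subset_left
  have hcover : f '' U ∩ A ⊆ W₁ ∪ W₂ := by
    rintro _ ⟨⟨z, hz, rfl⟩, hzA⟩
    rcases hc hzA with h | h
    · exact Or.inl (h₁.subset (mem_image_of_mem f ⟨hz, h⟩)).1
    · exact Or.inr (h₂.subset (mem_image_of_mem f ⟨hz, h⟩)).1
  obtain ⟨u, ⟨huU, huA⟩, hu₁, hu₂⟩ := (hU.convex_image.inter hA).isPreconnected W₁ W₂ hW₁ hW₂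
    hcover ⟨f a, ⟨mem_image_of_mem f ha, haA⟩, (h₁.subset (mem_image_of_mem f ⟨ha, ha₁⟩)).1⟩
    ⟨f b, ⟨mem_image_of_mem f hb, hbA⟩, (h₂.subset (mem_image_of_mem f ⟨hb, hb₂⟩)).1⟩
  obtain ⟨p, ⟨hpU, hp₁⟩, hpu⟩ := h₁.superset ⟨hu₁, huU⟩
  obtain ⟨q, ⟨hqU, hq₂⟩, hqu⟩ := h₂.superset ⟨hu₂, huU⟩
  have hpq : f p = f q := hpu.trans hqu.symm
  have hK := hU.lfc p hpU q hqU hpq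
  have hKA : connectedComponentIn (f ⁻¹' {f p}) p ⊆ f ⁻¹' A := fun z hz => by
    have : f z = f p := connectedComponentIn_subset (f ⁻¹' {f p}) _ hz
    rw [mem_preimage, this, hpu]
    exact huA
  have hqK : q ∈ connectedComponentIn (f ⁻¹' {f p}) p := by
    rw [hK]
    exact mem_connectedComponentIn hpq.symm
  obtain ⟨z, hzK, hz₁, hz₂⟩ := isPreconnected_connectedComponentIn O₁ O₂ ho₁ ho₂
    (hKA.trans hc) ⟨p, mem_connectedComponentIn rfl, hp₁⟩ ⟨q, hqK, hq₂⟩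
  exact hd z (hKA hzK) hz₁ hz₂

/-! ### Descent through sublevel sets -/

/-- A separation at level `s` thickens to disjoint open sets by normality. The image of the
uncovered rest is closed and misses level `s`, so by compactness it misses some higher level too. -/
theorem notSeparatedIn_sublevel_of_forall_gt {X V : Type*} [TopologicalSpace X]
    [NormalSpace X] [NormedAddCommGroup V] {f : X → V} {g : V → ℝ} (hcont : Continuous f)
    (hclosed : IsClosedMap f) (hg : Continuous g) (hcomp : ∀ s, IsCompact {v | g v ≤ s})
    {x y : X} {s : ℝ} (hx : g (f x) ≤ s) (hy : g (f y) ≤ s)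
    (h : ∀ t, s < t → NotSeparatedIn (f ⁻¹' {v | g v ≤ t}) x y) :
    NotSeparatedIn (f ⁻¹' {v | g v ≤ s}) x y := by
  intro O₁ O₂ ho₁ ho₂ hc hd hx₁
  have hP : IsClosed (f ⁻¹' {v | g v ≤ s}) := (hcomp s).isClosed.preimage hcont
  obtain ⟨N₁, N₂, hN₁, hN₂, hsub₁, hsub₂, hdisj⟩ := normal_separation
    (hP.inter ho₂.isClosed_compl) (hP.inter ho₁.isClosed_compl)
    (disjoint_left.2 fun z hz hz' => (hc hz.1).elim hz'.2 hz.2)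
  have hcov : f ⁻¹' {v | g v ≤ s} ⊆ N₁ ∪ N₂ := fun z hz => by
    rcases hc hz with h₁ | h₂
    · exact Or.inl (hsub₁ ⟨hz, hd z hz h₁⟩)
    · exact Or.inr (hsub₂ ⟨hz, fun h₁ => hd z hz h₁ h₂⟩)
  have hF : IsClosed (f '' (N₁ ∪ N₂)ᶜ) := hclosed _ (hN₁.union hN₂).isClosed_compl
  obtain ⟨t, hst, ht⟩ : ∃ t, s < t ∧ f ⁻¹' {v | g v ≤ t} ⊆ N₁ ∪ N₂ := by
    rcases ({v | g v ≤ s + 1} ∩ f '' (N₁ ∪ N₂)ᶜ).eq_empty_or_nonempty with hE | hE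
    · refine ⟨s + 1, lt_add_one s, fun z hz => ?_⟩
      by_contra hzN
      exact hE.subset ⟨hz, mem_image_of_mem f hzN⟩
    · obtain ⟨m, ⟨-, z₀, hz₀, rfl⟩, hmin⟩ :=
        ((hcomp (s + 1)).inter_right hF).exists_isMinOn hE hg.continuousOn
      have hsm : s < g (f z₀) := by
        by_contra hle
        exact hz₀ (hcov (not_lt.1 hle))
      -- The bound `s + 1` is needed because `f z₀` minimizes `g` only within that level.
      obtain ⟨t, hst, ht⟩ := exists_between (lt_min hsm (lt_add_one s))
      refine ⟨t, hst, fun z (hz : g (f z) ≤ t) => ?_⟩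
      by_contra hzN
      have h1 : g (f z₀) ≤ g (f z) := isMinOn_iff.1 hmin (f z)
        ⟨hz.trans (ht.le.trans (min_le_right _ _)), mem_image_of_mem f hzN⟩
      exact absurd (h1.trans hz) (ht.trans_le (min_le_left _ _)).not_ge
  have hyN := h t hst N₁ N₂ hN₁ hN₂ ht (fun z _ h₁ h₂ => disjoint_left.1 hdisj h₁ h₂)
    (hsub₁ ⟨hx, hd x hx hx₁⟩)
  by_contra hy₁
  exact disjoint_left.1 hdisj hyN (hsub₂ ⟨hy, hy₁⟩)

section Sublevel

variable {X V : Type*} [TopologicalSpace X] [NormedAddCommGroup V] [NormedSpace ℝ V]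
  {f : X → V} {g : V → ℝ}

theorem exists_notSeparatedIn_sublevel [PreconnectedSpace X] (hcont : Continuous f)
    (hchart : ∀ x, ∃ U, x ∈ U ∧ IsConvexChart f U) (hg : Continuous g) (hgc : ConvexOn ℝ univ g)
    (x y : X) : ∃ s, 0 ≤ s ∧ NotSeparatedIn (f ⁻¹' {v | g v ≤ s}) x y := by
  have hconv : ∀ s, Convex ℝ {v | g v ≤ s} := fun s => by simpa using hgc.convex_le s
  have hgf : Continuous fun z => g (f z) := hg.comp hcont
  have key : ∀ {a b : X} {U : Set X}, IsConvexChart f U → a ∈ U → b ∈ U →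
      (∃ s, 0 ≤ s ∧ NotSeparatedIn (f ⁻¹' {v | g v ≤ s}) x a) →
      ∃ s, 0 ≤ s ∧ NotSeparatedIn (f ⁻¹' {v | g v ≤ s}) x b := by
    rintro a b U hU ha hb ⟨s, hs, hsa⟩
    refine ⟨max s (max (g (f a)) (g (f b))), le_max_of_le_left hs,
      (hsa.mono fun z (hz : g (f z) ≤ s) => show g (f z) ≤ _ from le_max_of_le_left hz).trans
        (hU.notSeparatedIn (hconv _) ha hb ?_ ?_)⟩
    · exact (le_max_left (g (f a)) _).trans (le_max_right _ _)
    · exact (le_max_right _ (g (f b))).trans (le_max_right _ _)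
  have hclopen : IsClopen {z | ∃ s, 0 ≤ s ∧ NotSeparatedIn (f ⁻¹' {v | g v ≤ s}) x z} := by
    refine ⟨isClosed_of_closure_subset fun z hz => ?_, isOpen_iff_mem_nhds.2 fun z hz => ?_⟩
    · obtain ⟨U, hzU, hU⟩ := hchart z
      obtain ⟨a, haU, ha⟩ := mem_closure_iff.1 hz U hU.isOpen hzU
      exact key hU haU hzU ha
    · obtain ⟨U, hzU, hU⟩ := hchart z
      exact Filter.mem_of_superset (hU.isOpen.mem_nhds hzU) fun b hb => key hU hzU hb hz
  have := hclopen.eq_univ ⟨x, 0, le_rfl, .refl _ _⟩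
  exact this.symm.subset (mem_univ y)

/-- Otherwise the charts meeting `D` and those missing `D` would separate `x` from `y` at level `s`.
-/
theorem exists_lt_notSeparatedIn_sublevel
    (hchart : ∀ x, ∃ U, x ∈ U ∧ IsConvexChart f U) (hgc : ConvexOn ℝ univ g)
    {x y : X} {s : ℝ} (hs : 0 < s) (hx : g (f x) ≤ 0) (hy : g (f y) ≤ 0)
    (h : NotSeparatedIn (f ⁻¹' {v | g v ≤ s}) x y) :
    ∃ t, 0 ≤ t ∧ t < s ∧ NotSeparatedIn (f ⁻¹' {v | g v ≤ t}) x y := by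
  have hconv : ∀ s, Convex ℝ {v | g v ≤ s} := fun s => by simpa using hgc.convex_le s
  set D : Set X := {z | g (f z) < s ∧
    ∃ t, 0 ≤ t ∧ t < s ∧ NotSeparatedIn (f ⁻¹' {v | g v ≤ t}) x z} with hD
  have key : ∀ {a b : X} {U : Set X}, IsConvexChart f U → a ∈ U → b ∈ U → a ∈ D →
      g (f b) < s → b ∈ D := by
    rintro a b U hU ha hb ⟨has, t, ht0, hts, hta⟩ hbs
    refine ⟨hbs, max t (max (g (f a)) (g (f b))), le_max_of_le_left ht0,
      max_lt hts (max_lt has hbs),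
      (hta.mono fun z (hz : g (f z) ≤ t) => show g (f z) ≤ _ from le_max_of_le_left hz).trans
        (hU.notSeparatedIn (hconv _) ha hb ?_ ?_)⟩
    · exact (le_max_left (g (f a)) _).trans (le_max_right _ _)
    · exact (le_max_right _ (g (f b))).trans (le_max_right _ _)
  have hxD : x ∈ D := ⟨hx.trans_lt hs, 0, le_rfl, hs, .refl _ _⟩
  have hopen : ∀ p : Set X → Prop, IsOpen (⋃₀ {U | IsConvexChart f U ∧ p U}) :=
    fun p => isOpen_sUnion fun U hU => hU.1.isOpen
  have hyO := h (⋃₀ {U | IsConvexChart f U ∧ (U ∩ D).Nonempty})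
    (⋃₀ {U | IsConvexChart f U ∧ ¬ (U ∩ D).Nonempty}) (hopen _) (hopen _) ?_ ?_ ?_
  · obtain ⟨U, ⟨hU, a, haU, haD⟩, hyU⟩ := hyO
    exact (key hU haU hyU haD (hy.trans_lt hs)).2
  · intro z _
    obtain ⟨U, hzU, hU⟩ := hchart z
    by_cases hUD : (U ∩ D).Nonempty
    · exact Or.inl ⟨U, ⟨hU, hUD⟩, hzU⟩
    · exact Or.inr ⟨U, ⟨hU, hUD⟩, hzU⟩
  · rintro z hz ⟨U₁, ⟨hU₁, a, haU, haD⟩, hzU₁⟩ ⟨U₂, ⟨hU₂, hU₂D⟩, hzU₂⟩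
    obtain ⟨W, hW, hWU⟩ := hU₁.image_open (U₁ ∩ U₂) (hU₁.isOpen.inter hU₂.isOpen)
      inter_subset_left
    have hzW : f z ∈ W := (hWU.subset (mem_image_of_mem f ⟨hzU₁, hzU₂⟩)).1
    -- Moving from `f z` slightly towards `f a` goes strictly below level `s`; openness lifts this
    -- to a point of both charts.
    have hlim : Filter.Tendsto (fun t : ℝ => (1 - t) • f z + t • f a) (𝓝[>] 0) (𝓝 (f z)) := by
      have : Continuous fun t : ℝ => (1 - t) • f z + t • f a := by fun_prop
      simpa using (this.tendsto 0).mono_left nhdsWithin_le_nhds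
    obtain ⟨t, htW, ht⟩ := ((hlim.eventually (hW.mem_nhds hzW)).and
      (Ioo_mem_nhdsGT (zero_lt_one' ℝ))).exists
    have htU : (1 - t) • f z + t • f a ∈ f '' U₁ :=
      hU₁.convex_image (mem_image_of_mem f hzU₁) (mem_image_of_mem f haU)
        (by linarith [ht.2]) ht.1.le (by ring)
    obtain ⟨b, ⟨hb₁, hb₂⟩, hb⟩ := hWU.superset ⟨htW, htU⟩
    have hbs : g (f b) < s := by
      rw [hb]
      have h1 := hgc.2 (mem_univ (f z)) (mem_univ (f a)) (sub_nonneg.2 ht.2.le) ht.1.le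
        (by ring : (1 - t) + t = 1)
      have h2 : g (f z) ≤ s := hz
      simp only [smul_eq_mul] at h1
      nlinarith [mul_le_mul_of_nonneg_left h2 (sub_nonneg.2 ht.2.le),
        mul_lt_mul_of_pos_left haD.1 ht.1]
    exact hU₂D ⟨b, hb₂, key hU₁ haU hb₁ haD hbs⟩
  · obtain ⟨U, hxU, hU⟩ := hchart x
    exact ⟨U, ⟨hU, x, hxU, hxD⟩, hxU⟩

theorem notSeparatedIn_sublevel_zero [PreconnectedSpace X] [NormalSpace X] (hcont : Continuous f)
    (hclosed : IsClosedMap f) (hchart : ∀ x, ∃ U, x ∈ U ∧ IsConvexChart f U) (hg : Continuous g)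
    (hgc : ConvexOn ℝ univ g) (hcomp : ∀ s, IsCompact {v | g v ≤ s}) {x y : X}
    (hx : g (f x) ≤ 0) (hy : g (f y) ≤ 0) : NotSeparatedIn (f ⁻¹' {v | g v ≤ 0}) x y := by
  set T : Set ℝ := {s | 0 ≤ s ∧ NotSeparatedIn (f ⁻¹' {v | g v ≤ s}) x y} with hT
  have hne : T.Nonempty := exists_notSeparatedIn_sublevel hcont hchart hg hgc x y
  have hbdd : BddBelow T := ⟨0, fun s hs => hs.1⟩
  have h0 : 0 ≤ sInf T := le_csInf hne fun s hs => hs.1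
  have hinf : NotSeparatedIn (f ⁻¹' {v | g v ≤ sInf T}) x y := by
    refine notSeparatedIn_sublevel_of_forall_gt hcont hclosed hg hcomp (hx.trans h0)
      (hy.trans h0) fun t ht => ?_
    obtain ⟨s, hs, hst⟩ := exists_lt_of_csInf_lt hne ht
    exact hs.2.mono fun z hz => le_trans hz hst.le
  rcases h0.eq_or_lt with h | h
  · rwa [← h] at hinf
  · obtain ⟨t, ht0, hts, ht⟩ := exists_lt_notSeparatedIn_sublevel hchart hgc h hx hy hinf
    exact absurd (csInf_le hbdd ⟨ht0, ht⟩) hts.not_ge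

end Sublevel

/-! ### Compact convex sets, fibers and the image -/

theorem Convex.convexOn_infDist_of_isCompact {V : Type*} [NormedAddCommGroup V] [NormedSpace ℝ V]
    {K : Set V} (hK : Convex ℝ K) (hc : IsCompact K) (hne : K.Nonempty) :
    ConvexOn ℝ univ fun v => Metric.infDist v K := by
  refine ⟨convex_univ, fun a _ b _ s t hs ht hst => ?_⟩
  obtain ⟨p, hp, hap⟩ := hc.exists_infDist_eq_dist hne a
  obtain ⟨q, hq, hbq⟩ := hc.exists_infDist_eq_dist hne b
  simp only [hap, hbq, smul_eq_mul]
  refine (Metric.infDist_le_dist_of_mem (hK hp hq hs ht hst)).trans ?_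
  calc dist (s • a + t • b) (s • p + t • q) ≤ dist (s • a) (s • p) + dist (t • b) (t • q) :=
        dist_add_add_le _ _ _ _
    _ = s * dist a p + t * dist b q := by
        rw [dist_smul₀, dist_smul₀, Real.norm_of_nonneg hs, Real.norm_of_nonneg ht]

theorem notSeparatedIn_preimage_of_isCompact {X V : Type*} [TopologicalSpace X]
    [PreconnectedSpace X] [NormalSpace X] [NormedAddCommGroup V] [NormedSpace ℝ V]
    [FiniteDimensional ℝ V] {f : X → V} (hcont : Continuous f) (hclosed : IsClosedMap f)
    (hchart : ∀ x, ∃ U, x ∈ U ∧ IsConvexChart f U) {K : Set V} (hK : Convex ℝ K)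
    (hKc : IsCompact K) {x y : X} (hx : f x ∈ K) (hy : f y ∈ K) :
    NotSeparatedIn (f ⁻¹' K) x y := by
  have hne : K.Nonempty := ⟨_, hx⟩
  have : ProperSpace V := FiniteDimensional.proper ℝ V
  have hg : Continuous fun v => Metric.infDist v K := Metric.continuous_infDist_pt K
  have hK0 : K = {v | Metric.infDist v K ≤ 0} := by
    ext v
    rw [hKc.isClosed.mem_iff_infDist_zero hne]
    exact ⟨fun h => h.le, fun h => le_antisymm h Metric.infDist_nonneg⟩
  have hcomp : ∀ s, IsCompact {v | Metric.infDist v K ≤ s} := fun s => by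
    refine (hKc.cthickening (r := s)).of_isClosed_subset (isClosed_le hg continuous_const)
      fun v hv => ?_
    obtain ⟨p, hp, hvp⟩ := hKc.exists_infDist_eq_dist hne v
    exact Metric.mem_cthickening_of_dist_le v p s K hp (hvp ▸ hv)
  have := notSeparatedIn_sublevel_zero hcont hclosed hchart hg
    (hK.convexOn_infDist_of_isCompact hKc hne) hcomp (x := x) (y := y) (hK0.subset hx)
    (hK0.subset hy)
  rwa [← hK0] at this

theorem isConnected_fiber {X V : Type*} [TopologicalSpace X]
    [PreconnectedSpace X] [NormalSpace X] [NormedAddCommGroup V] [NormedSpace ℝ V]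
    [FiniteDimensional ℝ V] {f : X → V} (hcont : Continuous f) (hclosed : IsClosedMap f)
    (hchart : ∀ x, ∃ U, x ∈ U ∧ IsConvexChart f U) (x : X) : IsConnected (f ⁻¹' {f x}) := by
  set K := connectedComponentIn (f ⁻¹' {f x}) x with hKdef
  have hxK : x ∈ K := mem_connectedComponentIn rfl
  suffices h : f ⁻¹' {f x} ⊆ K by
    rw [h.antisymm (connectedComponentIn_subset _ _)]
    exact ⟨⟨x, hxK⟩, isPreconnected_connectedComponentIn⟩
  -- (LFC) makes fiber components relatively open, so being unseparated yields connectedness.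
  have key : ∀ {a b : X} {U : Set X}, IsConvexChart f U → a ∈ U → b ∈ U → a ∈ K →
      f b = f x → b ∈ K := by
    intro a b U hU ha hb haK hbx
    have hax : f a = f x := connectedComponentIn_subset (f ⁻¹' {f x}) _ haK
    have h1 := hU.lfc a ha b hb (hax.trans hbx.symm)
    rw [hax] at h1
    rw [hKdef, connectedComponentIn_eq haK, h1]
    exact mem_connectedComponentIn hbx
  intro y hy
  have hsep := notSeparatedIn_preimage_of_isCompact hcont hclosed hchart
    (convex_singleton (f x)) isCompact_singleton (x := x) (y := y) rfl hy
  have hopen : ∀ p : Set X → Prop, IsOpen (⋃₀ {U | IsConvexChart f U ∧ p U}) :=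
    fun p => isOpen_sUnion fun U hU => hU.1.isOpen
  have hyO := hsep (⋃₀ {U | IsConvexChart f U ∧ (U ∩ K).Nonempty})
    (⋃₀ {U | IsConvexChart f U ∧ ¬ (U ∩ K).Nonempty}) (hopen _) (hopen _) ?_ ?_ ?_
  · obtain ⟨U, ⟨hU, a, haU, haK⟩, hyU⟩ := hyO
    exact key hU haU hyU haK hy
  · intro z _
    obtain ⟨U, hzU, hU⟩ := hchart z
    by_cases hUK : (U ∩ K).Nonempty
    · exact Or.inl ⟨U, ⟨hU, hUK⟩, hzU⟩
    · exact Or.inr ⟨U, ⟨hU, hUK⟩, hzU⟩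
  · rintro z hz ⟨U₁, ⟨hU₁, a, haU, haK⟩, hzU₁⟩ ⟨U₂, ⟨hU₂, hU₂K⟩, hzU₂⟩
    exact hU₂K ⟨z, hzU₂, key hU₁ haU hzU₁ haK hz⟩
  · obtain ⟨U, hxU, hU⟩ := hchart x
    exact ⟨U, ⟨hU, x, hxU, hxK⟩, hxU⟩

theorem convex_range_of_isConvexChart {X V : Type*} [TopologicalSpace X]
    [PreconnectedSpace X] [NormalSpace X] [NormedAddCommGroup V] [NormedSpace ℝ V]
    [FiniteDimensional ℝ V] {f : X → V} (hcont : Continuous f) (hclosed : IsClosedMap f)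
    (hchart : ∀ x, ∃ U, x ∈ U ∧ IsConvexChart f U) : Convex ℝ (range f) := by
  rw [convex_iff_segment_subset]
  rintro _ ⟨x, rfl⟩ _ ⟨y, rfl⟩ w hw
  by_contra hwr
  have hcpt : ∀ a b : V, IsCompact (segment ℝ a b) := fun a b => by
    rw [segment_eq_image_lineMap]
    exact isCompact_Icc.image AffineMap.lineMap_continuous
  have hsep := notSeparatedIn_preimage_of_isCompact hcont hclosed hchart
    (convex_segment (f x) (f y)) (hcpt _ _) (left_mem_segment ℝ _ _) (right_mem_segment ℝ _ _)
  have hwb : Wbtw ℝ (f x) w (f y) := mem_segment_iff_wbtw.1 hw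
  -- The two half-segments meet only in the missed value `w`, so their preimages are disjoint and
  -- closed.
  refine hsep (f ⁻¹' segment ℝ w (f y))ᶜ (f ⁻¹' segment ℝ (f x) w)ᶜ
    ((hcpt _ _).isClosed.preimage hcont).isOpen_compl
    ((hcpt _ _).isClosed.preimage hcont).isOpen_compl ?_ ?_ ?_ (right_mem_segment ℝ _ _)
  · intro z _
    rw [← compl_inter, mem_compl_iff]
    rintro ⟨h1, h2⟩
    have h1 : Wbtw ℝ w (f z) (f y) := mem_segment_iff_wbtw.1 h1
    have h2 : Wbtw ℝ (f x) (f z) w := mem_segment_iff_wbtw.1 h2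
    have h3 : Wbtw ℝ (f z) w (f y) := hwb.trans_left_right h2
    exact hwr ⟨z, (wbtw_swap_left_iff ℝ (f y)).1 ⟨h3, h1⟩ |>.symm ▸ rfl⟩
  · intro z hz h1 h2
    have hz' : f z ∈ segment ℝ (f x) (f y) := hz
    rw [segment_eq_image_lineMap] at hz' hw
    obtain ⟨a, ha, haz⟩ := hz'
    obtain ⟨b, hb, hbw⟩ := hw
    have htot := wbtw_or_wbtw_smul_vadd_of_nonneg (f x) (f y -ᵥ f x) ha.1 hb.1
    rw [← AffineMap.lineMap_apply, ← AffineMap.lineMap_apply, haz, hbw] at htot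
    rcases htot with h | h
    · exact h2 (mem_segment_iff_wbtw.2 h)
    · exact h1 (mem_segment_iff_wbtw.2 ((mem_segment_iff_wbtw.1 hz).trans_left_right h))
  · intro h1
    have h1 : Wbtw ℝ w (f x) (f y) := mem_segment_iff_wbtw.1 h1
    exact hwr ⟨x, (wbtw_swap_left_iff ℝ (f y)).1 ⟨hwb, h1⟩⟩

/-! ### Openness onto the image -/

theorem IsConvexChart.map_nhds_eq {X V : Type*} [TopologicalSpace X] [NormedAddCommGroup V]
    [NormedSpace ℝ V] {f : X → V} {U : Set X} (hU : IsConvexChart f U) (hcont : Continuous f)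
    {x : X} (hx : x ∈ U) : Filter.map f (𝓝 x) = 𝓝[f '' U] (f x) := by
  refine le_antisymm (le_inf hcont.continuousAt ?_) fun s hs => ?_
  · rw [Filter.le_principal_iff]
    exact Filter.image_mem_map (hU.isOpen.mem_nhds hx)
  · obtain ⟨G, hG, hGo, hxG⟩ := mem_nhds_iff.1
      (Filter.inter_mem (Filter.mem_map.1 hs) (hU.isOpen.mem_nhds hx))
    obtain ⟨W, hW, hWU⟩ := hU.image_open G hGo fun z hz => (hG hz).2
    have hxW : f x ∈ W := (hWU.subset (mem_image_of_mem f hxG)).1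
    refine Filter.mem_of_superset (inter_mem_nhdsWithin _ (hW.mem_nhds hxW)) ?_
    rw [inter_comm, ← hWU]
    rintro _ ⟨z, hz, rfl⟩
    exact (hG hz).1

theorem map_nhds_eq_nhdsWithin_range {X V : Type*} [TopologicalSpace X] [NormedAddCommGroup V]
    [NormedSpace ℝ V] {f : X → V} (hcont : Continuous f) (hclosed : IsClosedMap f)
    (hchart : ∀ x, ∃ U, x ∈ U ∧ IsConvexChart f U) {x : X} (hx : IsConnected (f ⁻¹' {f x})) :
    Filter.map f (𝓝 x) = 𝓝[range f] (f x) := by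
  have hconst : ∀ y ∈ f ⁻¹' {f x}, Filter.map f (𝓝 y) = Filter.map f (𝓝 x) := by
    intro y hy
    refine hx.isPreconnected.induction₂ (fun a b => Filter.map f (𝓝 a) = Filter.map f (𝓝 b))
      (fun a ha => ?_) (fun _ _ _ _ _ _ => Eq.trans) (fun _ _ _ _ => Eq.symm) hy rfl
    obtain ⟨U, haU, hU⟩ := hchart a
    filter_upwards [self_mem_nhdsWithin, mem_nhdsWithin_of_mem_nhds (hU.isOpen.mem_nhds haU)]
      with b hb hbU
    rw [hU.map_nhds_eq hcont haU, hU.map_nhds_eq hcont hbU, ha, hb]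
  refine le_antisymm (le_inf hcont.continuousAt ?_) fun s hs => ?_
  · rw [Filter.le_principal_iff]
    exact Filter.range_mem_map
  · have h1 : ∀ᶠ v in 𝓝 (f x), ∀ z ∈ f ⁻¹' {v}, f z ∈ s :=
      hclosed.eventually_nhds_fiber (p := fun z => f z ∈ s) (f x) fun y hy => by
        have : s ∈ Filter.map f (𝓝 y) := by rwa [hconst y hy]
        exact this
    rw [mem_nhdsWithin_iff_eventually]
    filter_upwards [h1]
    rintro _ hv ⟨z, rfl⟩
    exact hv z rfl

theorem mainTheorem2 {X V : Type*} [TopologicalSpace X] [ConnectedSpace X]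
    [LocallyConnectedSpace X] [FirstCountableTopology X] [T2Space X] [NormalSpace X]
    [NormedAddCommGroup V] [InnerProductSpace ℝ V] [FiniteDimensional ℝ V]
    (f : X → V) (hcont : Continuous f) (hclosed : IsClosedMap f)
    (hlcd : HasLocalConvexityData f) (hlfc : IsLocallyFiberConnected f) :
    (∀ v ∈ Set.range f, IsConnected (f ⁻¹' {v})) ∧
      IsOpenMap (Set.rangeFactorization f) ∧
      IsClosed (Set.range f) ∧ Convex ℝ (Set.range f) := by
  have hchart := exists_isConvexChart hcont hlcd hlfc
  have hfib := isConnected_fiber hcont hclosed hchart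
  refine ⟨?_, ?_, hclosed.isClosed_range, convex_range_of_isConvexChart hcont hclosed hchart⟩
  · rintro _ ⟨x, rfl⟩
    exact hfib x
  · refine IsOpenMap.of_nhds_le fun x => ?_
    have h := map_nhds_eq_nhdsWithin_range hcont hclosed hchart (hfib x)
    rw [nhds_subtype_eq_comap_nhdsWithin]
    change Filter.comap Subtype.val (𝓝[range f] (f x)) ≤ _
    rw [← h, show f = Subtype.val ∘ Set.rangeFactorization f from rfl, ← Filter.map_map]
    exact (Filter.comap_map Subtype.val_injective).le
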